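/- Let $\mathfrak S$ be the Schrödinger algebra, i.e. the complex Lie algebra with basis $e,h,f,p,q,z$ and brackets $[h,e]=2e$, $[h,f]=-2f$, $[e,f]=h$, $[h,p]=p$, $[h,q]=-q$, $[p,q]=z$, $[e,q]=p$, $[p,f]=-q$, $[f,q]=0$, $[e,p]=0$, $[z,\mathfrak S]=0$, and let $\mathcal H=\mathrm{span}_{\mathbb C}\{p,q,z\}$ be its Heisenberg subalgebra. For a Lie algebra homomorphism $\phi:\mathcal H\to\mathbb C$, a vector $v$ of an $\mathfrak S$-module is called a quasi-Whittaker vector of type $\phi$ if $v\neq 0$ and $xv=\phi(x)v$ for all $x\in\mathcal H$. Put $C_0=p^2f-q^2e-hpq\in U(\mathfrak S)$. Let $\phi:\mathcal H\to\mathbb C$ be a nonzero Lie algebra homomorphism, and let $V$ be a quasi-Whittaker module of type $\phi$ with cyclic quasi-Whittaker vector $w$; that is, $V$ is an $\mathfrak S$-module, $w\in V$ is a quasi-Whittaker vector of type $\phi$, and $V=U(\mathfrak S)w$. Then the set of quasi-Whittaker vectors of type $\phi$ in $V$ is exactly $\mathbb C[C_0]w\setminus\{0\}$, where $\mathbb C[C_0]w=\{d(C_0)w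 : d\in\mathbb C[x]\}$. The set of all quasi-Whittaker vectors in $V$, of whatever type $\psi:\mathcal H\to\mathbb C$, is also exactly $\mathbb C[C_0]w\setminus\{0\}$. -/

import Mathlib

/-- The Schrödinger algebra: the complex vector space with basis `e, h, f, p, q, z`.
An element is the list of its six coordinates in this basis. -/
@[ext]
structure SchrodingerAlgebra where
  ce : ℂ
  ch : ℂ
  cf : ℂ
  cp : ℂ
  cq : ℂ
  cz : ℂ

namespace SchrodingerAlgebra

instance : Zero SchrodingerAlgebra := ⟨⟨0, 0, 0, 0, 0, 0⟩⟩
instance : Add SchrodingerAlgebra :=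
  ⟨fun x y => ⟨x.ce + y.ce, x.ch + y.ch, x.cf + y.cf, x.cp + y.cp, x.cq + y.cq, x.cz + y.cz⟩⟩
instance : Neg SchrodingerAlgebra :=
  ⟨fun x => ⟨-x.ce, -x.ch, -x.cf, -x.cp, -x.cq, -x.cz⟩⟩
instance : SMul ℂ SchrodingerAlgebra :=
  ⟨fun c x => ⟨c * x.ce, c * x.ch, c * x.cf, c * x.cp, c * x.cq, c * x.cz⟩⟩

/-- The Lie bracket: the bilinear alternating extension of
`[h,e] = 2e`, `[h,f] = -2f`, `[e,f] = h`, `[h,p] = p`, `[h,q] = -q`, `[p,q] = z`,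
`[e,q] = p`, `[p,f] = -q`, `[f,q] = 0`, `[e,p] = 0`, `z` central. -/
instance : Bracket SchrodingerAlgebra SchrodingerAlgebra :=
  ⟨fun x y =>
    { ce := 2 * (x.ch * y.ce - x.ce * y.ch)
      ch := x.ce * y.cf - x.cf * y.ce
      cf := -2 * (x.ch * y.cf - x.cf * y.ch)
      cp := (x.ch * y.cp - x.cp * y.ch) + (x.ce * y.cq - x.cq * y.ce)
      cq := -(x.ch * y.cq - x.cq * y.ch) - (x.cp * y.cf - x.cf * y.cp)
      cz := x.cp * y.cq - x.cq * y.cp }⟩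

theorem zero_def : (0 : SchrodingerAlgebra) = ⟨0, 0, 0, 0, 0, 0⟩ := rfl
theorem add_def (x y : SchrodingerAlgebra) : x + y =
    ⟨x.ce + y.ce, x.ch + y.ch, x.cf + y.cf, x.cp + y.cp, x.cq + y.cq, x.cz + y.cz⟩ := rfl
theorem neg_def (x : SchrodingerAlgebra) : -x =
    ⟨-x.ce, -x.ch, -x.cf, -x.cp, -x.cq, -x.cz⟩ := rfl
theorem smul_def (c : ℂ) (x : SchrodingerAlgebra) : c • x =
    ⟨c * x.ce, c * x.ch, c * x.cf, c * x.cp, c * x.cq, c * x.cz⟩ := rfl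
theorem bracket_def (x y : SchrodingerAlgebra) : ⁅x, y⁆ =
    { ce := 2 * (x.ch * y.ce - x.ce * y.ch)
      ch := x.ce * y.cf - x.cf * y.ce
      cf := -2 * (x.ch * y.cf - x.cf * y.ch)
      cp := (x.ch * y.cp - x.cp * y.ch) + (x.ce * y.cq - x.cq * y.ce)
      cq := -(x.ch * y.cq - x.cq * y.ch) - (x.cp * y.cf - x.cf * y.cp)
      cz := x.cp * y.cq - x.cq * y.cp : SchrodingerAlgebra } := rfl

instance : AddCommGroup SchrodingerAlgebra where
  add_assoc x y z := by ext <;> simp only [add_def] <;> ring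
  zero_add x := by ext <;> simp only [add_def, zero_def] <;> ring
  add_zero x := by ext <;> simp only [add_def, zero_def] <;> ring
  add_comm x y := by ext <;> simp only [add_def] <;> ring
  neg_add_cancel x := by ext <;> simp only [add_def, neg_def, zero_def] <;> ring
  nsmul := nsmulRec
  zsmul := zsmulRec

instance : Module ℂ SchrodingerAlgebra where
  one_smul x := by ext <;> simp only [smul_def] <;> ring
  mul_smul c d x := by ext <;> simp only [smul_def] <;> ring
  smul_zero c := by ext <;> simp only [smul_def, zero_def] <;> ring
  smul_add c x y := by ext <;> simp only [smul_def, add_def] <;> ring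
  add_smul c d x := by ext <;> simp only [smul_def, add_def] <;> ring
  zero_smul x := by ext <;> simp only [smul_def, zero_def] <;> ring

instance : LieRing SchrodingerAlgebra where
  add_lie x y z := by ext <;> simp only [bracket_def, add_def] <;> ring
  lie_add x y z := by ext <;> simp only [bracket_def, add_def] <;> ring
  lie_self x := by ext <;> simp only [bracket_def, zero_def] <;> ring
  leibniz_lie x y z := by ext <;> simp only [bracket_def, add_def] <;> ring

instance : LieAlgebra ℂ SchrodingerAlgebra where
  lie_smul c x y := by ext <;> simp only [bracket_def, smul_def] <;> ring

/-- The basis vector `e`. -/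
def e : SchrodingerAlgebra := ⟨1, 0, 0, 0, 0, 0⟩
/-- The basis vector `h`. -/
def h : SchrodingerAlgebra := ⟨0, 1, 0, 0, 0, 0⟩
/-- The basis vector `f`. -/
def f : SchrodingerAlgebra := ⟨0, 0, 1, 0, 0, 0⟩
/-- The basis vector `p`. -/
def p : SchrodingerAlgebra := ⟨0, 0, 0, 1, 0, 0⟩
/-- The basis vector `q`. -/
def q : SchrodingerAlgebra := ⟨0, 0, 0, 0, 1, 0⟩
/-- The basis vector `z`. -/
def z : SchrodingerAlgebra := ⟨0, 0, 0, 0, 0, 1⟩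

/-- The defining relations hold. -/
theorem bracket_table :
    ⁅h, e⁆ = (2 : ℂ) • e ∧ ⁅h, f⁆ = (-2 : ℂ) • f ∧ ⁅e, f⁆ = h ∧
    ⁅h, p⁆ = p ∧ ⁅h, q⁆ = -q ∧ ⁅p, q⁆ = z ∧
    ⁅e, q⁆ = p ∧ ⁅p, f⁆ = -q ∧ ⁅f, q⁆ = 0 ∧ ⁅e, p⁆ = 0 ∧
    ∀ x : SchrodingerAlgebra, ⁅z, x⁆ = 0 := by
  refine ⟨?_, ?_, ?_, ?_, ?_, ?_, ?_, ?_, ?_, ?_, ?_⟩ <;> (try intro x) <;> ext <;>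
    simp [bracket_def, smul_def, neg_def, zero_def, e, h, f, p, q, z]

/-- The Heisenberg subalgebra, the span of `p, q, z`. -/
def heisenberg : LieSubalgebra ℂ SchrodingerAlgebra where
  toSubmodule := Submodule.span ℂ {p, q, z}
  lie_mem' := by
    have key : ∀ x : SchrodingerAlgebra,
        x ∈ Submodule.span ℂ {p, q, z} ↔ x.ce = 0 ∧ x.ch = 0 ∧ x.cf = 0 := by
      intro x
      simp only [Submodule.mem_span_insert, Submodule.mem_span_singleton]
      constructor
      · rintro ⟨a, _, ⟨b, _, ⟨c, rfl⟩, rfl⟩, rfl⟩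
        simp [smul_def, add_def, p, q, z]
      · rintro ⟨h1, h2, h3⟩
        refine ⟨x.cp, _, ⟨x.cq, _, ⟨x.cz, rfl⟩, rfl⟩, ?_⟩
        ext <;> simp [smul_def, add_def, p, q, z, h1, h2, h3]
    intro x y hx hy
    have hx' := (key x).1 hx
    have hy' := (key y).1 hy
    refine (key _).2 ?_
    simp [bracket_def, hx'.1, hx'.2.1, hx'.2.2, hy'.1, hy'.2.1, hy'.2.2]

/-- The enveloping algebra `U(S)` of the Schrödinger algebra. -/
abbrev Env : Type := UniversalEnvelopingAlgebra ℂ SchrodingerAlgebra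

/-- The canonical map from the Schrödinger algebra to its enveloping algebra. -/
noncomputable abbrev toEnv (x : SchrodingerAlgebra) : Env :=
  UniversalEnvelopingAlgebra.ι ℂ x

/-- The element `C₀ = p² f - q² e - h p q` of `U(S)`. -/
noncomputable def C₀ : Env :=
  toEnv p ^ 2 * toEnv f - toEnv q ^ 2 * toEnv e - toEnv h * toEnv p * toEnv q

section Modules

variable {V : Type*} [AddCommGroup V] [Module ℂ V]
  [LieRingModule SchrodingerAlgebra V] [LieModule ℂ SchrodingerAlgebra V]

/-- The action `u v` of `u ∈ U(S)` on a vector `v` of an `S`-module. -/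
noncomputable def act (u : Env) (v : V) : V :=
  UniversalEnvelopingAlgebra.lift ℂ (LieModule.toEnd ℂ SchrodingerAlgebra V) u v

/-- `v` is a quasi-Whittaker vector of type `φ`: `v ≠ 0` and `x v = φ(x) v` for all `x`
in the Heisenberg subalgebra. -/
def IsQuasiWhittakerVector (φ : LieAlgebra.LieCharacter ℂ heisenberg) (v : V) : Prop :=
  v ≠ 0 ∧ ∀ x : heisenberg, ⁅(x : SchrodingerAlgebra), v⁆ = φ x • v

/-- `v` is cyclic: `U(S) v = V`. -/
def IsCyclicVector (v : V) : Prop :=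
  ∀ v' : V, ∃ u : Env, act u v = v'

/-- `ℂ[C₀] w`, the set of all `d(C₀) w` with `d` a polynomial. -/
def C₀Orbit (w : V) : Set V :=
  {v | ∃ d : Polynomial ℂ, v = act (Polynomial.aeval C₀ d) w}

end Modules

end SchrodingerAlgebra

/-!
On a cyclic module `V` generated by a quasi-Whittaker vector `w` of type `φ`, the central element `z`
acts by `φ z = φ [p, q] = 0`. Hence `p` and `q` commute on `V`, and `C₀` commutes with the whole
algebra (`lie_act_C₀`). So every nonzero vector of `ℂ[C₀] w` is quasi-Whittaker of type `φ`.

For the converse, elements of the Heisenberg subalgebra are ad-nilpotent, so each such `x` has `φ x` as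
its only eigenvalue on `V` (`eq_of_lie_eq_smul`); in particular every quasi-Whittaker vector has
type `φ`. Since `φ ≠ 0`, a suitable element of `SL₂` transforms the basis `e, h, f, p, q` into
`E, H, F, P, Q` with `P w = w` and `Q w = 0`, and it leaves `C₀` unchanged
(`isStandardFrame_of_det_eq_one`, `act_C₀_eq_of_det`). In this basis `F w = C₀ w`, so
`V = ℂ[E] ℂ[H] ℂ[C₀] w`. The operator `Q` acts like an injective multiple of `d/dE` on expansions in
powers of `E`, and `P - 1` acts like a difference operator on expansions in rising factorials of `H`.
Although `V` need not be free over `ℂ[E]` or `ℂ[H]` a priori, lowering operators of this kind force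
uniqueness of expansions and confine their kernels to the constant terms (`mem_of_mem_ladderSpan`).
The joint kernel of `Q` and `P - 1` is thus `ℂ[C₀] w` (`mem_of_frame`).
-/

namespace SchrodingerAlgebra

/-! ### Expansions along an operator, and lowering operators -/

section LadderSpan

variable {V : Type*} [AddCommGroup V] [Module ℂ V]

/-- The product `(x + (n-1)s) ⋯ (x + s) x` of `n` shifted copies of `x`. For `s = 0` it is the power
`x ^ n`; for `s = 1` it is the rising factorial of `x`. -/
def ladder (x : Module.End ℂ V) (s : ℂ) : ℕ → Module.End ℂ V
  | 0 => 1
  | n + 1 => (x + (n * s) • 1) * ladder x s n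

/-- The subspace `ℂ[x] K`. It is written as the sum of the images of `K` under the `ladder x s n`,
which for every step `s` span the same space as the powers of `x`. -/
def ladderSpan (x : Module.End ℂ V) (s : ℂ) (K : Submodule ℂ V) : Submodule ℂ V :=
  ⨆ n, K.map (ladder x s n)

theorem le_ladderSpan (x : Module.End ℂ V) (s : ℂ) (K : Submodule ℂ V) :
    K ≤ ladderSpan x s K :=
  le_iSup_of_le 0 (by rw [ladder]; exact (Submodule.map_id K).ge)

/-- `ladderSpan x s K` is contained in every `x`-stable subspace containing `K`. -/
theorem ladderSpan_le {x : Module.End ℂ V} {s : ℂ} {K N : Submodule ℂ V} (hK : K ≤ N)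
    (hx : ∀ v ∈ N, x v ∈ N) : ladderSpan x s K ≤ N := by
  refine iSup_le fun n => ?_
  rintro _ ⟨k, hk, rfl⟩
  induction n with
  | zero => simpa [ladder] using hK hk
  | succ n ih =>
    simpa [ladder] using N.add_mem (hx _ ih) (N.smul_mem (n * s) ih)

theorem apply_mem_ladderSpan {x : Module.End ℂ V} {s : ℂ} {K : Submodule ℂ V} {v : V}
    (hv : v ∈ ladderSpan x s K) : x v ∈ ladderSpan x s K := by
  suffices ladderSpan x s K ≤ (ladderSpan x s K).comap x from this hv
  refine iSup_le fun n => ?_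
  rintro _ ⟨k, hk, rfl⟩
  have mem : ∀ m, ladder x s m k ∈ ladderSpan x s K := fun m =>
    Submodule.mem_iSup_of_mem m (Submodule.mem_map_of_mem hk)
  have := Submodule.sub_mem _ (mem (n + 1)) (Submodule.smul_mem _ (n * s) (mem n))
  simpa [ladder] using this

/-- Criterion for `ℂ[x] K` to be stable under another operator `y`: it is enough to look at `K` and
at the passage from `v` to `x v`. -/
theorem apply_mem_ladderSpan_of {x y : Module.End ℂ V} {s : ℂ} {K : Submodule ℂ V}
    (hK : ∀ k ∈ K, y k ∈ ladderSpan x s K)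
    (hx : ∀ v ∈ ladderSpan x s K, y v ∈ ladderSpan x s K → y (x v) ∈ ladderSpan x s K)
    {v : V} (hv : v ∈ ladderSpan x s K) : y v ∈ ladderSpan x s K := by
  suffices ladderSpan x s K ≤ ladderSpan x s K ⊓ (ladderSpan x s K).comap y from (this hv).2
  exact ladderSpan_le (fun k hk => ⟨le_ladderSpan x s K hk, hK k hk⟩)
    fun v hv => ⟨apply_mem_ladderSpan hv.1, hx v hv.1 hv.2⟩

theorem exists_eq_sum_ladder {x : Module.End ℂ V} {s : ℂ} {K : Submodule ℂ V} {v : V}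
    (hv : v ∈ ladderSpan x s K) :
    ∃ (n : ℕ) (k : ℕ → V), (∀ i, k i ∈ K) ∧
      v = ∑ i ∈ Finset.range n, ladder x s i (k i) := by
  obtain ⟨g, hg, rfl⟩ := (Submodule.mem_iSup_iff_exists_finsupp _ _).1 hv
  choose k hk hkg using hg
  refine ⟨g.support.sup id + 1, k, hk, ?_⟩
  simp only [hkg]
  refine Finset.sum_subset (fun i hi => ?_) fun i _ hi => by simpa using hi
  exact Finset.mem_range.2 (Nat.lt_succ_of_le (Finset.le_sup (f := id) hi))

/-- An operator that acts like a derivative in `x`, up to an operator `σ` on the coefficients, sends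
an expansion of length `n + 1` to one of length `n`. -/
theorem apply_sum_ladder {x D σ : Module.End ℂ V} {s : ℂ} {K : Submodule ℂ V}
    (hD : ∀ k ∈ K, D k = 0)
    (hlow : ∀ n : ℕ, ∀ k ∈ K, D (ladder x s (n + 1) k) = -((n : ℂ) + 1) • ladder x s n (σ k))
    (n : ℕ) (k : ℕ → V) (hk : ∀ i, k i ∈ K) :
    D (∑ i ∈ Finset.range (n + 1), ladder x s i (k i)) =
      ∑ i ∈ Finset.range n, ladder x s i (-((i : ℂ) + 1) • σ (k (i + 1))) := by
  rw [Finset.sum_range_succ', map_add, map_sum]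
  simp only [hlow _ _ (hk _), map_smul]
  simp [ladder, hD _ (hk 0)]

/-- Expansions along the ladder with coefficients in `K` are unique. Nothing is assumed about freeness:
applying `D` repeatedly isolates the leading coefficient. -/
theorem eq_zero_of_sum_ladder_eq_zero {x D σ : Module.End ℂ V} {s : ℂ} {K : Submodule ℂ V}
    (hσK : ∀ k ∈ K, σ k ∈ K) (hσ : ∀ k ∈ K, σ k = 0 → k = 0) (hD : ∀ k ∈ K, D k = 0)
    (hlow : ∀ n : ℕ, ∀ k ∈ K, D (ladder x s (n + 1) k) = -((n : ℂ) + 1) • ladder x s n (σ k))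
    (n : ℕ) (k : ℕ → V) (hk : ∀ i, k i ∈ K)
    (hsum : ∑ i ∈ Finset.range n, ladder x s i (k i) = 0) : ∀ i < n, k i = 0 := by
  induction n generalizing k with
  | zero => simp
  | succ n ih =>
    have hpos : ∀ i < n, k (i + 1) = 0 := fun i hi => by
      have h0 := ih (fun i => -((i : ℂ) + 1) • σ (k (i + 1)))
        (fun i => K.smul_mem _ (hσK _ (hk _)))
        (by rw [← apply_sum_ladder hD hlow n k hk, hsum, map_zero]) i hi
      exact hσ _ (hk _)
        ((smul_eq_zero.1 h0).resolve_left (neg_ne_zero.2 (Nat.cast_add_one_ne_zero i)))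
    rw [Finset.sum_range_succ', Finset.sum_eq_zero fun i hi => by
      rw [hpos i (Finset.mem_range.1 hi), map_zero]] at hsum
    rintro (_ | i) hi
    · simpa [ladder] using hsum
    · exact hpos i (by omega)

/-- The kernel of the lowering operator `D` in `ℂ[x] K` is contained in `K`. -/
theorem mem_of_mem_ladderSpan {x D σ : Module.End ℂ V} {s : ℂ} {K : Submodule ℂ V}
    (hσK : ∀ k ∈ K, σ k ∈ K) (hσ : ∀ k ∈ K, σ k = 0 → k = 0) (hD : ∀ k ∈ K, D k = 0)
    (hlow : ∀ n : ℕ, ∀ k ∈ K, D (ladder x s (n + 1) k) = -((n : ℂ) + 1) • ladder x s n (σ k))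
    {v : V} (hv : v ∈ ladderSpan x s K) (hDv : D v = 0) : v ∈ K := by
  obtain ⟨n, k, hk, rfl⟩ := exists_eq_sum_ladder hv
  cases n with
  | zero => simp
  | succ n =>
    rw [apply_sum_ladder hD hlow n k hk] at hDv
    have h0 := eq_zero_of_sum_ladder_eq_zero hσK hσ hD hlow n _
      (fun i => K.smul_mem _ (hσK _ (hk _))) hDv
    rw [Finset.sum_range_succ', Finset.sum_eq_zero fun i hi => ?_]
    · simpa [ladder] using hk 0
    · rw [hσ _ (hk (i + 1)) ((smul_eq_zero.1 (h0 i (Finset.mem_range.1 hi))).resolve_left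
        (neg_ne_zero.2 (Nat.cast_add_one_ne_zero i))), map_zero]

/-- If `[Q, E] = -P` and `[P, E] = 0`, then on `ker Q` the commutator of `Q` and `E ^ (n + 1)` is
`-(n + 1) E ^ n P`. -/
theorem lower_ladder_zero_succ {E P Q : Module.End ℂ V} {K : Submodule ℂ V}
    (hP : ∀ v, P (E v) = E (P v)) (hQ : ∀ v, Q (E v) = E (Q v) - P v)
    (hK : ∀ k ∈ K, Q k = 0) (n : ℕ) {k : V} (hk : k ∈ K) :
    Q (ladder E 0 (n + 1) k) = -((n : ℂ) + 1) • ladder E 0 n (P k) := by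
  have hPn : ∀ n, P (ladder E 0 n k) = ladder E 0 n (P k) := fun n => by
    induction n with
    | zero => simp [ladder]
    | succ n ih => simp [ladder, hP, ih]
  induction n with
  | zero => simp [ladder, hQ, hK k hk]
  | succ n ih =>
    have e1 : ∀ m u, ladder E 0 (m + 1) u = E (ladder E 0 m u) := fun m u => by simp [ladder]
    rw [e1 (n + 1), hQ, ih, hPn, map_smul, ← e1]
    push_cast
    module

/-- If `[P, H] = -P`, then `P` shifts `H` to `H - 1`, and `P - 1` acts on rising factorials of `H` as
a difference operator. -/
theorem sub_one_ladder_one_succ {H P : Module.End ℂ V} {K : Submodule ℂ V}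
    (hP : ∀ v, P (H v) = H (P v) - P v) (hK : ∀ k ∈ K, P k = k)
    (n : ℕ) {k : V} (hk : k ∈ K) :
    (P - 1) (ladder H 1 (n + 1) k) = -((n : ℂ) + 1) • ladder H 1 n k := by
  have e1 : ∀ m, ladder H 1 (m + 1) k = H (ladder H 1 m k) + (m : ℂ) • ladder H 1 m k :=
    fun m => by simp [ladder]
  induction n with
  | zero => simp [ladder, hP, hK k hk]
  | succ n ih =>
    have h1 : P (ladder H 1 (n + 1) k) =
        ladder H 1 (n + 1) k - ((n : ℂ) + 1) • ladder H 1 n k := by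
      rw [LinearMap.sub_apply, Module.End.one_apply, sub_eq_iff_eq_add] at ih
      rw [ih]; module
    rw [e1 (n + 1), LinearMap.sub_apply, Module.End.one_apply, map_add, map_smul, hP, h1]
    simp only [map_sub, map_smul]
    rw [e1 n]
    simp only [map_add, map_smul]
    push_cast
    module

end LadderSpan

/-! ### The Heisenberg subalgebra and stable subspaces -/

/-- A subspace stable under the Schrödinger algebra is stable under its enveloping algebra. -/
theorem act_mem {V : Type*} [AddCommGroup V] [Module ℂ V]
    [LieRingModule SchrodingerAlgebra V] [LieModule ℂ SchrodingerAlgebra V] (N : Submodule ℂ V)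
    (hN : ∀ x : SchrodingerAlgebra, ∀ v ∈ N, ⁅x, v⁆ ∈ N) (u : Env) {v : V} (hv : v ∈ N) :
    act u v ∈ N := by
  obtain ⟨t, rfl⟩ : ∃ t, UniversalEnvelopingAlgebra.mkAlgHom ℂ SchrodingerAlgebra t = u :=
    RingCon.mkₐ_surjective _ u
  induction t using TensorAlgebra.induction generalizing v with
  | algebraMap r => simpa [act, Module.algebraMap_end_apply] using N.smul_mem r hv
  | ι x => simpa [act] using hN x v hv
  | mul a b ha hb =>
    have := ha (hb hv)
    simpa [act] using this
  | add a b ha hb => simpa [act] using N.add_mem (ha hv) (hb hv)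

theorem coeff_of_mem_heisenberg {x : SchrodingerAlgebra} (hx : x ∈ heisenberg) :
    x.ce = 0 ∧ x.ch = 0 ∧ x.cf = 0 := by
  obtain ⟨a, b, c, rfl⟩ := Submodule.mem_span_triple.1
    (show x ∈ Submodule.span ℂ {p, q, z} from hx)
  simp [add_def, smul_def, p, q, z]

section GenEigenspace

variable {V : Type*} [AddCommGroup V] [Module ℂ V]
  [LieRingModule SchrodingerAlgebra V] [LieModule ℂ SchrodingerAlgebra V]

/-- Elements of the Heisenberg subalgebra are ad-nilpotent, so on a cyclic module they have the
eigenvalue of the generating vector as their only generalized eigenvalue. -/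
theorem mem_maxGenEigenspace_of_cyclic {x : SchrodingerAlgebra} (hx : x ∈ heisenberg) {c : ℂ}
    {w : V} (hw : ⁅x, w⁆ = c • w) (hcyc : IsCyclicVector w) (v : V) :
    v ∈ (LieModule.toEnd ℂ SchrodingerAlgebra V x).maxGenEigenspace c := by
  obtain ⟨u, rfl⟩ := hcyc v
  refine act_mem _ (fun y m hm => ?_) u ?_
  · have hy : y ∈ (LieModule.toEnd ℂ SchrodingerAlgebra SchrodingerAlgebra x).maxGenEigenspace
        0 := by
      rw [Module.End.mem_maxGenEigenspace]
      -- `ad x` maps the whole algebra into `span {p, q, z}`, that into `ℂ z`, and `z` to `0`.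
      refine ⟨3, ?_⟩
      obtain ⟨h1, h2, h3⟩ := coeff_of_mem_heisenberg hx
      simp [pow_succ, bracket_def, h1, h2, h3, zero_def]
    simpa using LieModule.lie_mem_maxGenEigenspace_toEnd hy hm
  · exact Module.End.eigenspace_le_maxGenEigenspace (by simpa using hw)

theorem eq_of_lie_eq_smul {x : SchrodingerAlgebra} (hx : x ∈ heisenberg) {c d : ℂ}
    {w : V} (hw : ⁅x, w⁆ = c • w) (hcyc : IsCyclicVector w) {v : V} (hv : ⁅x, v⁆ = d • v)
    (h0 : v ≠ 0) : d = c := by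
  by_contra hne
  refine h0 (Submodule.disjoint_def.1 (Module.End.disjoint_genEigenspace
    (LieModule.toEnd ℂ SchrodingerAlgebra V x) hne ⊤ ⊤) v ?_
    (mem_maxGenEigenspace_of_cyclic hx hw hcyc v))
  exact Module.End.eigenspace_le_maxGenEigenspace (by simpa using hv)

end GenEigenspace

/-! ### Standard bases attached to elements of `SL₂` -/

/-- The elements `E, H, F, P, Q`, together with `z`, span the Schrödinger algebra and satisfy the same
commutation relations as `e, h, f, p, q`; the relations `[P, Q] = z` and
`[F, Q] = 0` are left out. -/
structure IsStandardFrame (E H F P Q : SchrodingerAlgebra) : Prop where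
  lie_H_E : ⁅H, E⁆ = (2 : ℂ) • E
  lie_F_H : ⁅F, H⁆ = (2 : ℂ) • F
  lie_F_E : ⁅F, E⁆ = -H
  lie_P_H : ⁅P, H⁆ = -P
  lie_Q_H : ⁅Q, H⁆ = Q
  lie_Q_E : ⁅Q, E⁆ = -P
  lie_F_P : ⁅F, P⁆ = Q
  lie_P_E : ⁅P, E⁆ = 0
  exists_eq : ∀ x : SchrodingerAlgebra, ∃ a b c d r s : ℂ,
    x = a • E + b • H + c • F + d • P + r • Q + s • z

theorem sub_def (x y : SchrodingerAlgebra) : x - y =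
    ⟨x.ce - y.ce, x.ch - y.ch, x.cf - y.cf, x.cp - y.cp, x.cq - y.cq, x.cz - y.cz⟩ := by
  rw [sub_eq_add_neg]
  simp only [neg_def, add_def, ← sub_eq_add_neg]

/-- The images of `e, h, f, p, q` under the automorphism given by an element of `SL₂` that acts on
`p, q` as on the standard basis of `ℂ²` and on `e, h, f` by conjugation. -/
theorem isStandardFrame_of_det_eq_one {α β γ δ : ℂ} (hdet : α * δ - β * γ = 1) :
    IsStandardFrame (α ^ 2 • e - β ^ 2 • f - (α * β) • h)
      ((α * δ + β * γ) • h - (2 * α * γ) • e + (2 * β * δ) • f)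
      (δ ^ 2 • f - γ ^ 2 • e + (γ * δ) • h) (α • p + β • q) (γ • p + δ • q) := by
  constructor
  case exists_eq =>
    intro x
    refine ⟨δ ^ 2 * x.ce - γ ^ 2 * x.cf + 2 * γ * δ * x.ch,
      β * δ * x.ce + (α * δ + β * γ) * x.ch - α * γ * x.cf,
      -β ^ 2 * x.ce + α ^ 2 * x.cf - 2 * α * β * x.ch,
      δ * x.cp - γ * x.cq, -β * x.cp + α * x.cq, x.cz, ?_⟩
    ext <;> simp [smul_def, sub_def, add_def, e, h, f, p, q, z]
    all_goals grind
  all_goals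
    ext <;> simp [bracket_def, smul_def, neg_def, sub_def, add_def, zero_def, e, h, f, p, q]
  all_goals grind

/-! ### The element `C₀` is central on modules killed by `z` -/

section Action

variable {V : Type*} [AddCommGroup V] [Module ℂ V]
  [LieRingModule SchrodingerAlgebra V] [LieModule ℂ SchrodingerAlgebra V]

theorem act_C₀ (v : V) :
    act C₀ v = ⁅p, ⁅p, ⁅f, v⁆⁆⁆ - ⁅q, ⁅q, ⁅e, v⁆⁆⁆ - ⁅h, ⁅p, ⁅q, v⁆⁆⁆ := by
  simp only [act, C₀, toEnv, map_sub, map_mul, map_pow, UniversalEnvelopingAlgebra.lift_ι_apply]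
  simp [pow_two]

omit [Module ℂ V] [LieModule ℂ SchrodingerAlgebra V] in
theorem lie_q_p (hz : ∀ v : V, ⁅z, v⁆ = 0) (v : V) : ⁅q, ⁅p, v⁆⁆ = ⁅p, ⁅q, v⁆⁆ := by
  rw [leibniz_lie p q v, bracket_table.2.2.2.2.2.1, hz, zero_add]

/-- The product `p q` has weight `0`, so the factor `h` of `C₀` can be moved to the right. -/
theorem act_C₀_eq (v : V) :
    act C₀ v = ⁅p, ⁅p, ⁅f, v⁆⁆⁆ - ⁅q, ⁅q, ⁅e, v⁆⁆⁆ - ⁅p, ⁅q, ⁅h, v⁆⁆⁆ := by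
  obtain ⟨-, -, -, hhp, hhq, -⟩ := bracket_table
  rw [act_C₀, leibniz_lie h p, hhp, leibniz_lie h q, hhq]
  simp

theorem lie_act_C₀ (hz : ∀ v : V, ⁅z, v⁆ = 0) (x : SchrodingerAlgebra) (v : V) :
    ⁅x, act C₀ v⁆ = act C₀ ⁅x, v⁆ := by
  have hp : ⁅x, p⁆ = x.ch • p + x.cf • q - x.cq • z := by
    ext <;> simp [bracket_def, smul_def, sub_def, add_def, p, q, z]
  have hq : ⁅x, q⁆ = x.ce • p - x.ch • q + x.cp • z := by
    ext <;> simp [bracket_def, smul_def, sub_def, add_def, p, q, z]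
  have he : ⁅x, e⁆ = (2 * x.ch) • e - x.cf • h - x.cq • p := by
    ext <;> simp [bracket_def, smul_def, sub_def, e, h, p]
  have hf : ⁅x, f⁆ = x.ce • h - (2 * x.ch) • f - x.cp • q := by
    ext <;> simp [bracket_def, smul_def, sub_def, f, h, q]
  have hh : ⁅x, h⁆ = (2 * x.cf) • f - (2 * x.ce) • e - x.cp • p + x.cq • q := by
    ext <;> simp [bracket_def, smul_def, sub_def, add_def, e, f, h, p, q]
  simp only [act_C₀_eq, lie_sub, leibniz_lie x p, leibniz_lie x q, leibniz_lie x e,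
    leibniz_lie x f, leibniz_lie x h, hp, hq, he, hf, hh, add_lie, sub_lie, smul_lie, lie_add,
    lie_smul, hz, lie_q_p hz, smul_zero, sub_zero, add_zero]
  module

/-- `C₀` is invariant under `SL₂` on a module killed by `z`. -/
theorem act_C₀_eq_of_det (hz : ∀ v : V, ⁅z, v⁆ = 0) {α β γ δ : ℂ}
    (hdet : α * δ - β * γ = 1) (v : V) :
    act C₀ v =
      ⁅α • p + β • q, ⁅α • p + β • q, ⁅δ ^ 2 • f - γ ^ 2 • e + (γ * δ) • h, v⁆⁆⁆ -
      ⁅γ • p + δ • q, ⁅γ • p + δ • q, ⁅α ^ 2 • e - β ^ 2 • f - (α * β) • h, v⁆⁆⁆ -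
      ⁅α • p + β • q, ⁅γ • p + δ • q,
        ⁅(α * δ + β * γ) • h - (2 * α * γ) • e + (2 * β * δ) • f, v⁆⁆⁆ := by
  -- The right-hand side is the determinant squared times the left-hand side.
  have h2 : act C₀ v = (α * δ - β * γ) ^ 2 • act C₀ v := by rw [hdet]; simp
  rw [h2]
  simp only [act_C₀_eq, add_lie, sub_lie, smul_lie, lie_add, lie_sub,
    lie_smul, lie_q_p hz]
  module

theorem lie_act_aeval (hz : ∀ v : V, ⁅z, v⁆ = 0) (x : SchrodingerAlgebra) (d : Polynomial ℂ)
    (v : V) :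
    ⁅x, act (Polynomial.aeval C₀ d) v⁆ = act (Polynomial.aeval C₀ d) ⁅x, v⁆ := by
  have hc : Commute (LieModule.toEnd ℂ SchrodingerAlgebra V x)
      (UniversalEnvelopingAlgebra.lift ℂ (LieModule.toEnd ℂ SchrodingerAlgebra V) C₀) := by
    ext v
    exact lie_act_C₀ hz x v
  have hd : Commute (LieModule.toEnd ℂ SchrodingerAlgebra V x)
      (UniversalEnvelopingAlgebra.lift ℂ (LieModule.toEnd ℂ SchrodingerAlgebra V)
        (Polynomial.aeval C₀ d)) := by
    rw [← Polynomial.aeval_algHom_apply]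
    induction d using Polynomial.induction_on' with
    | add a b ha hb => rw [map_add]; exact ha.add_right hb
    | monomial n a =>
      rw [Polynomial.aeval_monomial]
      exact (Algebra.commute_algebraMap_right a _).mul_right (hc.pow_right n)
  exact LinearMap.congr_fun hd.eq v

/-! ### Joint eigenvectors in a cyclic module -/

/-- If `w` generates the module and is fixed by `P` and killed by `Q`, then every vector fixed by `P` and
killed by `Q` lies in `ℂ[C₀] w`. The module is `ℂ[E] ℂ[H] ℂ[C₀] w`; here `Q` lowers the degree in `E`, and `P - 1` lowers the
degree in `H`. -/
theorem mem_of_frame {E H F P Q : SchrodingerAlgebra} (hfr : IsStandardFrame E H F P Q)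
    (hz : ∀ v : V, ⁅z, v⁆ = 0)
    (hC : ∀ v : V, act C₀ v = ⁅P, ⁅P, ⁅F, v⁆⁆⁆ - ⁅Q, ⁅Q, ⁅E, v⁆⁆⁆ - ⁅P, ⁅Q, ⁅H, v⁆⁆⁆)
    (hPinj : ∀ v : V, ⁅P, v⁆ = 0 → v = 0)
    {w : V} (hPw : ⁅P, w⁆ = w) (hQw : ⁅Q, w⁆ = 0) (hcyc : IsCyclicVector w) {v : V}
    (hPv : ⁅P, v⁆ = v) (hQv : ⁅Q, v⁆ = 0) : v ∈ C₀Orbit w := by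
  have hHE : ∀ v : V, ⁅H, ⁅E, v⁆⁆ = ⁅E, ⁅H, v⁆⁆ + (2 : ℂ) • ⁅E, v⁆ := fun v => by
    rw [leibniz_lie H E, hfr.lie_H_E, smul_lie, add_comm]
  have hFH : ∀ v : V, ⁅F, ⁅H, v⁆⁆ = ⁅H, ⁅F, v⁆⁆ + (2 : ℂ) • ⁅F, v⁆ := fun v => by
    rw [leibniz_lie F H, hfr.lie_F_H, smul_lie, add_comm]
  have hFE : ∀ v : V, ⁅F, ⁅E, v⁆⁆ = ⁅E, ⁅F, v⁆⁆ - ⁅H, v⁆ := fun v => by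
    rw [leibniz_lie F E, hfr.lie_F_E, neg_lie, add_comm, sub_eq_add_neg]
  have hPH : ∀ v : V, ⁅P, ⁅H, v⁆⁆ = ⁅H, ⁅P, v⁆⁆ - ⁅P, v⁆ := fun v => by
    rw [leibniz_lie P H, hfr.lie_P_H, neg_lie, add_comm, sub_eq_add_neg]
  have hQH : ∀ v : V, ⁅Q, ⁅H, v⁆⁆ = ⁅H, ⁅Q, v⁆⁆ + ⁅Q, v⁆ := fun v => by
    rw [leibniz_lie Q H, hfr.lie_Q_H, add_comm]
  have hQE : ∀ v : V, ⁅Q, ⁅E, v⁆⁆ = ⁅E, ⁅Q, v⁆⁆ - ⁅P, v⁆ := fun v => by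
    rw [leibniz_lie Q E, hfr.lie_Q_E, neg_lie, add_comm, sub_eq_add_neg]
  have hPE : ∀ v : V, ⁅P, ⁅E, v⁆⁆ = ⁅E, ⁅P, v⁆⁆ := fun v => by
    rw [leibniz_lie P E, hfr.lie_P_E, zero_lie, zero_add]
  have hFP : ∀ v : V, ⁅F, ⁅P, v⁆⁆ = ⁅P, ⁅F, v⁆⁆ + ⁅Q, v⁆ := fun v => by
    rw [leibniz_lie F P, hfr.lie_F_P, add_comm]
  -- On `w` the other two terms of `C₀` vanish.
  have hFw : ⁅F, w⁆ = act C₀ w := by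
    have h1 : ⁅P, ⁅F, w⁆⁆ = ⁅F, w⁆ := by
      have := hFP w
      rwa [hPw, hQw, add_zero, eq_comm] at this
    simp [hC, h1, hQE, hQH, hQw, hPw]
  set D := LieModule.toEnd ℂ SchrodingerAlgebra V with hDdef
  -- `K₀ = ℂ[C₀] w`, on which `P = 1`, `Q = 0` and `F = C₀`.
  let K₀ : Submodule ℂ V := LinearMap.range
    ((LinearMap.applyₗ w).comp
      ((UniversalEnvelopingAlgebra.lift ℂ D).comp (Polynomial.aeval C₀)).toLinearMap)
  have hK₀ : ∀ k, k ∈ K₀ ↔ ∃ d : Polynomial ℂ, act (Polynomial.aeval C₀ d) w = k := fun k =>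
    Iff.rfl
  suffices v ∈ K₀ by
    obtain ⟨d, hd⟩ := (hK₀ v).1 this
    exact ⟨d, hd.symm⟩
  have hPK₀ : ∀ k ∈ K₀, ⁅P, k⁆ = k := by
    rintro _ ⟨d, rfl⟩
    exact (lie_act_aeval hz P d w).trans (by rw [hPw]; rfl)
  have hQK₀ : ∀ k ∈ K₀, ⁅Q, k⁆ = 0 := by
    rintro _ ⟨d, rfl⟩
    exact (lie_act_aeval hz Q d w).trans (by simp [hQw, act])
  have hFK₀ : ∀ k ∈ K₀, ⁅F, k⁆ ∈ K₀ := by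
    rintro _ ⟨d, rfl⟩
    refine ⟨d * Polynomial.X, Eq.trans ?_ (lie_act_aeval hz F d w).symm⟩
    rw [hFw]
    simp [act, hDdef]
  -- `K₁ = ℂ[H] K₀` is stable under `H`, `F` and `P`, and is killed by `Q`.
  let K₁ := ladderSpan (D H) 1 K₀
  have hPK₁ : ∀ k ∈ K₁, ⁅P, k⁆ ∈ K₁ := fun k hk =>
    apply_mem_ladderSpan_of (y := D P)
      (fun k hk => le_ladderSpan _ _ _ (by simpa [hDdef, hPK₀ k hk] using hk))
      (fun v hv hPv => by
        have := K₁.sub_mem (apply_mem_ladderSpan hPv) hPv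
        simpa [hDdef, hPH] using this) hk
  have hQK₁ : ∀ k ∈ K₁, ⁅Q, k⁆ = 0 := fun k hk => by
    refine ladderSpan_le (N := LinearMap.ker (D Q)) (fun k hk => hQK₀ k hk) (fun v hv => ?_) hk
    have hv : ⁅Q, v⁆ = 0 := hv
    simp [hDdef, hQH, hv]
  have hFK₁ : ∀ k ∈ K₁, ⁅F, k⁆ ∈ K₁ := fun k hk =>
    apply_mem_ladderSpan_of (y := D F) (fun k hk => le_ladderSpan _ _ _ (hFK₀ k hk))
      (fun v hv hFv => by
        have := K₁.add_mem (apply_mem_ladderSpan hFv) (K₁.smul_mem 2 hFv)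
        simpa [hDdef, hFH] using this) hk
  have hHK₁ : ∀ k ∈ K₁, ⁅H, k⁆ ∈ K₁ := fun k hk => apply_mem_ladderSpan hk
  -- `N = ℂ[E] K₁` is a submodule, and hence all of `V`.
  let N := ladderSpan (D E) 0 K₁
  have hEN : ∀ k ∈ N, ⁅E, k⁆ ∈ N := fun k hk => apply_mem_ladderSpan hk
  have hHN : ∀ k ∈ N, ⁅H, k⁆ ∈ N := fun k hk =>
    apply_mem_ladderSpan_of (y := D H) (fun k hk => le_ladderSpan _ _ _ (hHK₁ k hk))
      (fun v hv hHv => by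
        have := N.add_mem (apply_mem_ladderSpan hHv) (N.smul_mem 2 (hEN v hv))
        simpa [hDdef, hHE] using this) hk
  have hPN : ∀ k ∈ N, ⁅P, k⁆ ∈ N := fun k hk =>
    apply_mem_ladderSpan_of (y := D P) (fun k hk => le_ladderSpan _ _ _ (hPK₁ k hk))
      (fun v hv hPv => by
        have := apply_mem_ladderSpan hPv
        simpa [hDdef, hPE] using this) hk
  have hQN : ∀ k ∈ N, ⁅Q, k⁆ ∈ N := fun k hk =>
    apply_mem_ladderSpan_of (y := D Q) (fun k hk => by simp [hDdef, hQK₁ k hk])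
      (fun v hv hQv => by
        have := N.sub_mem (apply_mem_ladderSpan hQv) (hPN v hv)
        simpa [hDdef, hQE] using this) hk
  have hFN : ∀ k ∈ N, ⁅F, k⁆ ∈ N := fun k hk =>
    apply_mem_ladderSpan_of (y := D F) (fun k hk => le_ladderSpan _ _ _ (hFK₁ k hk))
      (fun v hv hFv => by
        have := N.sub_mem (apply_mem_ladderSpan hFv) (hHN v hv)
        simpa [hDdef, hFE] using this) hk
  have hwK₀ : w ∈ K₀ := ⟨1, by simp⟩
  have hvN : v ∈ N := by
    obtain ⟨u, rfl⟩ := hcyc v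
    refine act_mem N (fun x m hm => ?_) u (le_ladderSpan _ _ _ (le_ladderSpan _ _ _ hwK₀))
    obtain ⟨a, b, c, d, r, s, rfl⟩ := hfr.exists_eq x
    simp only [add_lie, smul_lie, hz, smul_zero, add_zero]
    exact N.add_mem (N.add_mem (N.add_mem (N.add_mem (N.smul_mem _ (hEN m hm))
      (N.smul_mem _ (hHN m hm))) (N.smul_mem _ (hFN m hm))) (N.smul_mem _ (hPN m hm)))
      (N.smul_mem _ (hQN m hm))
  have hvK₁ : v ∈ K₁ :=
    mem_of_mem_ladderSpan (D := D Q) (σ := D P) hPK₁ (fun k _ => hPinj k) hQK₁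
      (fun n k hk => lower_ladder_zero_succ (K := K₁) hPE hQE hQK₁ n hk) hvN hQv
  exact mem_of_mem_ladderSpan (D := D P - 1) (σ := 1) (fun k hk => hk) (fun k _ hk => hk)
    (fun k hk => by simp [hDdef, hPK₀ k hk])
    (fun n k hk => sub_one_ladder_one_succ (K := K₀) hPH hPK₀ n hk) hvK₁ (by simp [hDdef, hPv])

end Action

end SchrodingerAlgebra

open SchrodingerAlgebra in
/-- `V` is a quasi-Whittaker module of nonzero type `φ` with cyclic quasi-Whittaker vector `w`.
The set of its quasi-Whittaker vectors (of type `φ`, or of any type whatsoever) is the set of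
nonzero vectors of `ℂ[C₀] w`. -/
theorem theorem5p6 {V : Type*} [AddCommGroup V] [Module ℂ V]
    [LieRingModule SchrodingerAlgebra V] [LieModule ℂ SchrodingerAlgebra V]
    (φ : LieAlgebra.LieCharacter ℂ heisenberg) (hφ : φ ≠ 0)
    (w : V) (hw : IsQuasiWhittakerVector φ w) (hcyc : IsCyclicVector w) :
    {v : V | IsQuasiWhittakerVector φ v} = C₀Orbit w \ {0} ∧
    {v : V | ∃ ψ : LieAlgebra.LieCharacter ℂ heisenberg, IsQuasiWhittakerVector ψ v} = C₀Orbit w \ {0} := by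
  have hpm : p ∈ heisenberg := Submodule.subset_span (by simp)
  have hqm : q ∈ heisenberg := Submodule.subset_span (by simp)
  have hzm : z ∈ heisenberg := Submodule.subset_span (by simp)
  have hφz : φ ⟨z, hzm⟩ = 0 := by
    have h1 : (⟨z, hzm⟩ : heisenberg) = ⁅(⟨p, hpm⟩ : heisenberg), (⟨q, hqm⟩ : heisenberg)⁆ :=
      Subtype.ext bracket_table.2.2.2.2.2.1.symm
    rw [h1, LieAlgebra.lieCharacter_apply_lie]
  have hz : ∀ v : V, ⁅z, v⁆ = 0 := fun v => by
    obtain ⟨u, rfl⟩ := hcyc v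
    refine act_mem (LinearMap.ker (LieModule.toEnd ℂ SchrodingerAlgebra V z))
      (fun x m hm => ?_) u ?_
    · have hm : ⁅z, m⁆ = 0 := hm
      simp [leibniz_lie z x, bracket_table.2.2.2.2.2.2.2.2.2.2, hm]
    · have := hw.2 ⟨z, hzm⟩
      rw [hφz, zero_smul] at this
      simpa using this
  set a := φ ⟨p, hpm⟩ with ha
  set b := φ ⟨q, hqm⟩ with hb
  have hp : ∀ v : V, IsQuasiWhittakerVector φ v → ⁅p, v⁆ = a • v := fun v hv => hv.2 ⟨p, hpm⟩
  have hq : ∀ v : V, IsQuasiWhittakerVector φ v → ⁅q, v⁆ = b • v := fun v hv => hv.2 ⟨q, hqm⟩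
  obtain ⟨α, β, hαβ⟩ : ∃ α β : ℂ, α * a + β * b = 1 := by
    by_cases ha0 : a = 0
    · by_cases hb0 : b = 0
      · refine absurd (DFunLike.ext _ _ fun x => ?_) hφ
        obtain ⟨c, d, r, hx⟩ := Submodule.mem_span_triple.1
          (show (x : SchrodingerAlgebra) ∈ Submodule.span ℂ {p, q, z} from x.2)
        have hx' : x = c • ⟨p, hpm⟩ + d • ⟨q, hqm⟩ + r • ⟨z, hzm⟩ := Subtype.ext hx.symm
        rw [hx']
        simp only [map_add, map_smul, ← ha, ← hb, ha0, hb0, hφz]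
        simp
      · exact ⟨0, b⁻¹, by field_simp; simp⟩
    · exact ⟨a⁻¹, 0, by field_simp; simp⟩
  -- With `γ = -b` and `δ = a` the second element of the pair kills `w`.
  have hdet : α * a - β * (-b) = 1 := by linear_combination hαβ
  have hP : ∀ v : V, IsQuasiWhittakerVector φ v → ⁅α • p + β • q, v⁆ = v := fun v hv => by
    rw [add_lie, smul_lie, smul_lie, hp v hv, hq v hv, smul_smul, smul_smul, ← add_smul, hαβ,
      one_smul]
  have hQ : ∀ v : V, IsQuasiWhittakerVector φ v → ⁅(-b) • p + a • q, v⁆ = 0 := fun v hv => by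
    rw [add_lie, smul_lie, smul_lie, hp v hv, hq v hv]
    module
  have hPm : α • p + β • q ∈ heisenberg :=
    heisenberg.add_mem (heisenberg.smul_mem _ hpm) (heisenberg.smul_mem _ hqm)
  have hPinj : ∀ v : V, ⁅α • p + β • q, v⁆ = 0 → v = 0 := fun v hv => by
    by_contra h0
    exact zero_ne_one (eq_of_lie_eq_smul hPm (c := 1) (d := 0) (by rw [one_smul, hP w hw]) hcyc
      (by rw [hv, zero_smul]) h0)
  have hmem : ∀ v : V, IsQuasiWhittakerVector φ v → v ∈ C₀Orbit w \ {0} := fun v hv =>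
    ⟨mem_of_frame (isStandardFrame_of_det_eq_one hdet) hz (act_C₀_eq_of_det hz hdet) hPinj
      (hP w hw) (hQ w hw) hcyc (hP v hv) (hQ v hv), hv.1⟩
  have horbit : ∀ v ∈ C₀Orbit w \ {0}, IsQuasiWhittakerVector φ v := by
    rintro _ ⟨⟨d, rfl⟩, h0⟩
    refine ⟨h0, fun x => ?_⟩
    rw [lie_act_aeval hz, hw.2 x]
    simp [act]
  refine ⟨Set.ext fun v => ⟨hmem v, horbit v⟩,
    Set.ext fun v => ⟨?_, fun hv => ⟨φ, horbit v hv⟩⟩⟩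
  rintro ⟨ψ, hv⟩
  have hψ : ψ = φ := DFunLike.ext _ _ fun x => eq_of_lie_eq_smul x.2 (hw.2 x) hcyc (hv.2 x) hv.1
  exact hmem v (hψ ▸ hv)
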